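/- Let $(G,P)$ be a lattice ordered group, not necessarily abelian, with identity $e$ and positive cone $P=\{g\in G: g\ge e\}$. A representation of $P$ on a complex Hilbert space $\mathcal H$ is a unital semigroup homomorphism $T:P\to B(\mathcal H)$. It is contractive (isometric) if every $T(p)$ is a contraction (an isometry), and Nica-covariant if $T(s)T(t)^*=T(t)^*T(s)$ for all $s,t\in P$ with $s\wedge t=e$. A minimal isometric dilation of $T$ is an isometric representation $V:P\to B(\mathcal K)$ on a Hilbert space $\mathcal K\supseteq\mathcal H$ such that $P_{\mathcal H}V(p)|_{\mathcal H}=T(p)$ for all $p\in P$ and $\mathcal K=\bigvee_{p\in P}V(p)\mathcal H$. It is called regular if $P_{\mathcal H}V(p)^*V(q)|_{\mathcal H}=T(p)^*T(q)$ for all $p,q\in P$ with $p\wedge q=e$; that is, if $V$ dilates the extension $\tilde T(g)=T(g_-)^*T(g_+)$ of $T$ to $G$, where $g_+=g\vee e$ and $g_-=g^{-1}\vee e$. Let $T:P\to B(\mathcal H)$ be a contractive Nica-covariant representation. Then $T$ has a regular minimal isometric dilation, and every regular minimal isometric dilation $V:P\to B(\mathcal K)$ of $T$ is Nica-covariant.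 -/

import Mathlib

namespace LatticeOrderedSemigroup

open ContinuousLinearMap

/-- Representations of the positive cone `P = {g | 1 ≤ g}` of a lattice ordered group `G` on `H`:
unital semigroup homomorphisms from `P` to the bounded operators on `H`. -/
abbrev Rep (G : Type*) [Group G] [Lattice G] [MulLeftMono G]
    (H : Type*) [NormedAddCommGroup H] [InnerProductSpace ℂ H] :=
  Submonoid.oneLE G →* (H →L[ℂ] H)

variable {G : Type*} [Group G] [Lattice G] [MulLeftMono G]
variable {H : Type*} [NormedAddCommGroup H] [InnerProductSpace ℂ H] [CompleteSpace H]
variable {K : Type*} [NormedAddCommGroup K] [InnerProductSpace ℂ K] [CompleteSpace K]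

/-- `T` is contractive: every `T p` is a contraction. -/
def IsContractive (T : Rep G H) : Prop := ∀ p, ‖T p‖ ≤ 1

/-- `T` is isometric: every `T p` is an isometry. -/
def IsIsometric (T : Rep G H) : Prop := ∀ p, Isometry (T p)

/-- `T` is Nica-covariant: `T s` commutes with `(T t)†` whenever `s ∧ t = e`. -/
def IsNicaCovariant (T : Rep G H) : Prop :=
  ∀ s t : Submonoid.oneLE G, (s : G) ⊓ (t : G) = 1 →
    T s ∘L adjoint (T t) = adjoint (T t) ∘L T s

/-- `V` is an isometric dilation of `T`, where `H` sits in `K` through the isometric embedding `J`: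
`V` is isometric and the compression of `V p` to `H` is `T p`. -/
def IsIsometricDilation (T : Rep G H) (V : Rep G K) (J : H →ₗᵢ[ℂ] K) : Prop :=
  IsIsometric V ∧
    ∀ p, adjoint J.toContinuousLinearMap ∘L V p ∘L J.toContinuousLinearMap = T p

/-- The dilation is minimal: the closed linear span of all `V p (J h)` is `K`. -/
def IsMinimal (V : Rep G K) (J : H →ₗᵢ[ℂ] K) : Prop :=
  (Submodule.span ℂ {x : K | ∃ p h, x = V p (J h)}).topologicalClosure = ⊤

/-- The dilation is regular: for `p ∧ q = e` the compression of `(V p)† (V q)` to `H` is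
`(T p)† (T q)`. As every `g` in `G` is uniquely `q p⁻¹` with `p, q ≥ e` and `p ∧ q = e`, this says
that `V` dilates the extension `g ↦ (T g₋)† (T g₊)` of `T` to `G`. -/
def IsRegular (T : Rep G H) (V : Rep G K) (J : H →ₗᵢ[ℂ] K) : Prop :=
  ∀ p q : Submonoid.oneLE G, (p : G) ⊓ (q : G) = 1 →
    adjoint J.toContinuousLinearMap ∘L (adjoint (V p) ∘L V q) ∘L J.toContinuousLinearMap
      = adjoint (T p) ∘L T q

end LatticeOrderedSemigroup

open LatticeOrderedSemigroup

universe u v w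

/-! Existence amounts to positivity of the kernel `T̃(p⁻¹q)` on the cone: `V g` is then left
translation on its Kolmogorov decomposition. For positivity on a finite family
(`re_kernelForm_repKernel_nonneg`), choose a largest subfamily with a common lower bound `> e` and
divide it by its meet `g`. By maximality `g` is orthogonal to the other members. By Nica-covariance
the two forms differ by that of `K(1 - S)` on the other members, with `S = T(g)T(g)†` a self-adjoint
contraction commuting with the entries of `K` there; this term is nonnegative by
`re_kernelForm_comp_le`. Repeating the division makes all members `e`, where the form is `‖∑ h i‖²`.
For covariance, Gram matrix and minimality give `V(t)†V(r)J = V((t⁻¹r)₊) J T((r⁻¹t)₊)†`. If `s ∧ t =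
e`, replacing `r` by `sr` multiplies `(t⁻¹r)₊` by `s` on the left and leaves `(r⁻¹t)₊` unchanged. -/

namespace LatticeOrderedSemigroup

/-! ### Orthogonal elements and positive parts in a lattice ordered group. -/

section Group

variable {G : Type*} [Group G] [Lattice G]

theorem inf_eq_one_of_le {a b c : G} (h : a ⊓ b = 1) (hc : 1 ≤ c) (hcb : c ≤ b) : a ⊓ c = 1 :=
  le_antisymm (h ▸ inf_le_inf_left a hcb) (le_inf (h ▸ inf_le_left) hc)

variable [MulLeftMono G] [MulRightMono G]

theorem mul_eq_sup_of_inf_eq_one {a b : G} (h : a ⊓ b = 1) : a * b = a ⊔ b := by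
  have : a * (a ⊓ b)⁻¹ * b = a ⊔ b := by
    rw [inv_inf, mul_sup, sup_mul, mul_inv_cancel, one_mul, inv_mul_cancel_right, sup_comm]
  simpa [h] using this

theorem commute_of_inf_eq_one {a b : G} (h : a ⊓ b = 1) : Commute a b := by
  rw [Commute, SemiconjBy, mul_eq_sup_of_inf_eq_one h,
    mul_eq_sup_of_inf_eq_one (inf_comm a b ▸ h), sup_comm]

theorem inv_mul_sup_one (a b : G) : (a⁻¹ * b) ⊔ 1 = (a ⊓ b)⁻¹ * b := by
  rw [inv_inf, sup_mul, inv_mul_cancel]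

theorem inv_mul_sup_one_le {a b : G} (ha : 1 ≤ a) (hb : 1 ≤ b) : (a⁻¹ * b) ⊔ 1 ≤ b :=
  sup_le (mul_le_of_le_one_left' (inv_le_one'.2 ha)) hb

/-- The element `r = p ⊓ gq` is orthogonal to `g`, so `gr = g ⊔ r ≤ gq`; cancel `g`. -/
theorem inf_mul_eq_of_inf_eq_one {g p q : G} (h : g ⊓ p = 1) (hq : 1 ≤ q) :
    p ⊓ (g * q) = p ⊓ q := by
  have hg : 1 ≤ g := h ▸ inf_le_left
  have hp : 1 ≤ p := h ▸ inf_le_right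
  refine le_antisymm (le_inf inf_le_left ?_) (inf_le_inf_left p (le_mul_of_one_le_left' hg))
  have hr : g ⊓ (p ⊓ (g * q)) = 1 :=
    inf_eq_one_of_le h (le_inf hp (one_le_mul hg hq)) inf_le_left
  have := mul_eq_sup_of_inf_eq_one hr
  rw [← mul_le_mul_iff_left g, this]
  exact sup_le (le_mul_of_one_le_right' hq) inf_le_right

theorem inv_mul_mul_sup_one {g p q : G} (h : g ⊓ p = 1) (hq : 1 ≤ q) :
    (p⁻¹ * (g * q)) ⊔ 1 = g * ((p⁻¹ * q) ⊔ 1) := by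
  have hp : 1 ≤ p := h ▸ inf_le_right
  have hc : Commute g (p ⊓ q) :=
    commute_of_inf_eq_one (inf_eq_one_of_le h (le_inf hp hq) inf_le_left)
  rw [inv_mul_sup_one, inv_mul_sup_one, inf_mul_eq_of_inf_eq_one h hq, ← mul_assoc, ← mul_assoc,
    hc.inv_right.eq]

theorem mul_inv_mul_sup_one {g p q : G} (h : g ⊓ p = 1) (hq : 1 ≤ q) :
    ((g * q)⁻¹ * p) ⊔ 1 = (q⁻¹ * p) ⊔ 1 := by
  rw [inv_mul_sup_one, inv_mul_sup_one, inf_comm, inf_mul_eq_of_inf_eq_one h hq, inf_comm]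

theorem inv_mul_sup_one_inf (a b : G) : ((a⁻¹ * b) ⊔ 1) ⊓ ((b⁻¹ * a) ⊔ 1) = 1 := by
  rw [inv_mul_sup_one, inv_mul_sup_one, inf_comm b a, ← mul_inf, inf_comm b a, inv_mul_cancel]

end Group

open ContinuousLinearMap

section Cone

variable {G : Type*} [Group G] [Lattice G] [MulLeftMono G]

/-- The positive part `p⁻¹q ∨ e` of `p⁻¹q`, as an element of the positive cone. -/
def leftQuot (p q : Submonoid.oneLE G) : Submonoid.oneLE G := ⟨((p : G)⁻¹ * q) ⊔ 1, le_sup_right⟩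

theorem coe_leftQuot (p q : Submonoid.oneLE G) :
    (leftQuot p q : G) = ((p : G)⁻¹ * q) ⊔ 1 := rfl

theorem leftQuot_self (p : Submonoid.oneLE G) : leftQuot p p = 1 :=
  Subtype.ext (by simp [coe_leftQuot])

theorem leftQuot_one_left (p : Submonoid.oneLE G) : leftQuot 1 p = p :=
  Subtype.ext (by
    have : (1 : G) ≤ p := p.2
    simpa [coe_leftQuot] using this)

theorem leftQuot_one_right (p : Submonoid.oneLE G) : leftQuot p 1 = 1 :=
  Subtype.ext (by
    have : (1 : G) ≤ p := p.2
    simpa [coe_leftQuot] using this)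

theorem leftQuot_mul_mul_left (g p q : Submonoid.oneLE G) :
    leftQuot (g * p) (g * q) = leftQuot p q :=
  Subtype.ext (by simp [coe_leftQuot, mul_assoc])

theorem mul_leftQuot_of_le {g p : Submonoid.oneLE G} (h : (g : G) ≤ p) :
    g * leftQuot g p = p := by
  have : 1 ≤ (g : G)⁻¹ * p := le_inv_mul_iff_mul_le.2 (by simpa using h)
  exact Subtype.ext (by simp [coe_leftQuot, sup_eq_left.2 this])

variable [MulRightMono G]

theorem inf_leftQuot_eq_one {g q : Submonoid.oneLE G} (h : (g : G) ⊓ q = 1)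
    (p : Submonoid.oneLE G) : (g : G) ⊓ leftQuot p q = 1 :=
  inf_eq_one_of_le h (leftQuot p q).2 (inv_mul_sup_one_le p.2 q.2)

theorem leftQuot_mul_right {g p : Submonoid.oneLE G} (h : (g : G) ⊓ p = 1)
    (q : Submonoid.oneLE G) : leftQuot p (g * q) = g * leftQuot p q :=
  Subtype.ext (inv_mul_mul_sup_one h q.2)

theorem leftQuot_mul_left {g p : Submonoid.oneLE G} (h : (g : G) ⊓ p = 1)
    (q : Submonoid.oneLE G) : leftQuot (g * q) p = leftQuot q p :=
  Subtype.ext (mul_inv_mul_sup_one h q.2)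

theorem leftQuot_of_inf_eq_one {p q : Submonoid.oneLE G} (h : (p : G) ⊓ q = 1) :
    leftQuot p q = q :=
  Subtype.ext (by rw [coe_leftQuot, inv_mul_sup_one, h, inv_one, one_mul])

theorem leftQuot_inf_leftQuot (p q : Submonoid.oneLE G) :
    (leftQuot p q : G) ⊓ leftQuot q p = 1 :=
  inv_mul_sup_one_inf (p : G) q

theorem exists_mul_leftQuot (p q : Submonoid.oneLE G) :
    ∃ r, r * leftQuot p q = q ∧ r * leftQuot q p = p := by
  have hr : (1 : G) ≤ (p : G) ⊓ q := le_inf p.2 q.2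
  refine ⟨⟨(p : G) ⊓ q, hr⟩, Subtype.ext ?_, Subtype.ext ?_⟩
  · rw [Submonoid.coe_mul, coe_leftQuot, inv_mul_sup_one, mul_inv_cancel_left]
  · rw [Submonoid.coe_mul, coe_leftQuot, inv_mul_sup_one, inf_comm (q : G), mul_inv_cancel_left]

end Cone

/-! ### The kernel of a representation. -/

section Rep

variable {G : Type*} [Group G] [Lattice G] [MulLeftMono G]
variable {H : Type*} [NormedAddCommGroup H] [InnerProductSpace ℂ H]

theorem rep_commute [MulRightMono G] {T : Rep G H} {s t : Submonoid.oneLE G}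
    (h : (s : G) ⊓ t = 1) (x : H) : T s (T t x) = T t (T s x) := by
  have : s * t = t * s := Subtype.ext (commute_of_inf_eq_one h).eq
  simpa using congrArg (fun p => T p x) this

variable [CompleteSpace H]

theorem IsNicaCovariant.apply_adjoint {T : Rep G H} (hN : IsNicaCovariant T)
    {s t : Submonoid.oneLE G} (h : (s : G) ⊓ t = 1) (x : H) :
    T s (adjoint (T t) x) = adjoint (T t) (T s x) :=
  congrArg (fun A : H →L[ℂ] H => A x) (hN s t h)

/-- The kernel `(p, q) ↦ T̃(p⁻¹q)` on the positive cone, where `T̃(g) = (T g₋)† (T g₊)`. -/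
noncomputable def repKernel (T : Rep G H) :
    Matrix (Submonoid.oneLE G) (Submonoid.oneLE G) (H →L[ℂ] H) :=
  .of fun p q => adjoint (T (leftQuot q p)) ∘L T (leftQuot p q)

theorem inner_repKernel (T : Rep G H) (p q : Submonoid.oneLE G) (x y : H) :
    inner ℂ (repKernel T p q x) y =
      inner ℂ (T (leftQuot p q) x) (T (leftQuot q p) y) := by
  simp [repKernel, adjoint_inner_left]

theorem repKernel_isHermitian (T : Rep G H) : (repKernel T).IsHermitian := by
  ext p q : 1
  simp [repKernel, star_eq_adjoint, adjoint_comp]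

theorem repKernel_mul_left (T : Rep G H) (g p q : Submonoid.oneLE G) :
    repKernel T (g * p) (g * q) = repKernel T p q := by
  simp [repKernel, leftQuot_mul_mul_left]

theorem repKernel_self (T : Rep G H) (p : Submonoid.oneLE G) : repKernel T p p = 1 := by
  ext x
  simp [repKernel, leftQuot_self, ← star_eq_adjoint]

variable [MulRightMono G]

/-- Peeling off `g` from one argument, when `g` is orthogonal to the other one. -/
theorem repKernel_mul_right {T : Rep G H} (hN : IsNicaCovariant T) {g p : Submonoid.oneLE G}
    (h : (g : G) ⊓ p = 1) (q : Submonoid.oneLE G) :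
    repKernel T p (g * q) = T g ∘L repKernel T p q := by
  ext x
  simp only [repKernel, Matrix.of_apply, comp_apply]
  rw [leftQuot_mul_right h, leftQuot_mul_left h, map_mul,
    hN.apply_adjoint (inf_leftQuot_eq_one h _)]
  rfl

theorem repKernel_commute {T : Rep G H} (hN : IsNicaCovariant T) {g p q : Submonoid.oneLE G}
    (hp : (g : G) ⊓ p = 1) (hq : (g : G) ⊓ q = 1) (x : H) :
    T g (repKernel T p q x) = repKernel T p q (T g x) := by
  simp only [repKernel, Matrix.of_apply, comp_apply]
  rw [hN.apply_adjoint (inf_leftQuot_eq_one hp _), rep_commute (inf_leftQuot_eq_one hq _)]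

theorem repKernel_mul_left_right {T : Rep G H} (hN : IsNicaCovariant T)
    {g p : Submonoid.oneLE G} (h : (g : G) ⊓ p = 1) (q : Submonoid.oneLE G) :
    repKernel T (g * q) p = repKernel T q p ∘L adjoint (T g) := by
  rw [← (repKernel_isHermitian T).apply, repKernel_mul_right hN h, star_eq_adjoint, adjoint_comp,
    ← star_eq_adjoint, (repKernel_isHermitian T).apply]

end Rep

/-- If `a 1 / a 0 > 1`, repeated squaring makes `a (2 ^ k)` grow like `(a 1 / a 0) ^ 2 ^ k`, against
the bound `M`. -/
theorem apply_one_le_apply_zero_of_sq_le {a : ℕ → ℝ} {M : ℝ} (h0 : 0 ≤ a 0) (hM : ∀ n, a n ≤ M)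
    (h : ∀ n, a n ^ 2 ≤ a (2 * n) * a 0) : a 1 ≤ a 0 := by
  by_contra! hlt
  have h1 : 0 < a 1 := h0.trans_lt hlt
  have hpos : 0 < a 0 := by
    refine h0.lt_of_ne fun he => ?_
    have := h 1
    rw [← he, mul_zero] at this
    exact absurd this (not_le.2 (by positivity))
  have hc : 1 < a 1 / a 0 := (one_lt_div hpos).2 hlt
  have key (k : ℕ) : a 0 * (a 1 / a 0) ^ 2 ^ k ≤ a (2 ^ k) := by
    induction k with
    | zero => simp [mul_div_cancel₀ _ hpos.ne']
    | succ k ih =>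
      refine le_of_mul_le_mul_right ?_ hpos
      rw [pow_succ' 2 k]
      refine le_trans ?_ (h (2 ^ k))
      calc a 0 * (a 1 / a 0) ^ (2 * 2 ^ k) * a 0 = (a 0 * (a 1 / a 0) ^ 2 ^ k) ^ 2 := by ring
        _ ≤ a (2 ^ k) ^ 2 := by gcongr
  obtain ⟨n, hn⟩ := pow_unbounded_of_one_lt (M / a 0) hc
  rw [div_lt_iff₀' hpos] at hn
  refine absurd (hM (2 ^ n)) (not_le.2 (hn.trans_le (le_trans ?_ (key n))))
  gcongr
  · exact hc.le
  · exact Nat.lt_two_pow_self.le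

/-! ### Positive forms and commuting contractions. -/

section KernelForm

variable {ι X H : Type*} [NormedAddCommGroup H] [InnerProductSpace ℂ H]

/-- The sesquilinear form on `H`-valued families indexed by a finite set, given by the matrix
`K (p i) (p j)`. -/
noncomputable def kernelForm (K : Matrix X X (H →L[ℂ] H)) (p : ι → X) (s : Finset ι)
    (h k : ι → H) : ℂ :=
  ∑ i ∈ s, ∑ j ∈ s, inner ℂ (K (p i) (p j) (h j)) (k i)

variable {K : Matrix X X (H →L[ℂ] H)} {p : ι → X} {s : Finset ι}

theorem kernelForm_sub_smul_self (h u : ι → H) (t : ℝ) :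
    kernelForm K p s (u - (t : ℂ) • h) (u - (t : ℂ) • h) =
      kernelForm K p s u u - t * kernelForm K p s u h - t * kernelForm K p s h u
        + t * t * kernelForm K p s h h := by
  simp only [kernelForm, Pi.sub_apply, Pi.smul_apply, map_sub, map_smul, inner_sub_left,
    inner_sub_right, inner_smul_left, inner_smul_right, Complex.conj_ofReal, Finset.mul_sum,
    ← Finset.sum_sub_distrib, ← Finset.sum_add_distrib]
  refine Finset.sum_congr rfl fun i _ => Finset.sum_congr rfl fun j _ => ?_
  ring

theorem norm_kernelForm_le (h k : ι → H) : ‖kernelForm K p s h k‖ ≤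
    ∑ i ∈ s, ∑ j ∈ s, ‖K (p i) (p j)‖ * ‖h j‖ * ‖k i‖ := by
  refine norm_sum_le_of_le _ fun i _ => norm_sum_le_of_le _ fun j _ => ?_
  exact (norm_inner_le_norm _ _).trans
    (mul_le_mul_of_nonneg_right (le_opNorm _ _) (norm_nonneg _))

/-- Since `S` is symmetric for the form, Cauchy–Schwarz bounds the square of `a n = Re ⟨K Sⁿh, h⟩`
by `a (2n) * a 0`, and `a` is bounded because `‖S‖ ≤ 1`. No square root of `1 - S` is needed. -/
theorem re_kernelForm_comp_le [CompleteSpace H]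
    (hpos : ∀ h : ι → H, 0 ≤ (kernelForm K p s h h).re)
    {S : H →L[ℂ] H} (hS : IsSelfAdjoint S) (hS1 : ‖S‖ ≤ 1)
    (hcomm : ∀ i ∈ s, ∀ j ∈ s, Commute S (K (p i) (p j))) (h : ι → H) :
    (kernelForm K p s (S ∘ h) h).re ≤ (kernelForm K p s h h).re := by
  have move (n : ℕ) (u v : ι → H) :
      kernelForm K p s u (fun i => (S ^ n) (v i)) = kernelForm K p s (fun i => (S ^ n) (u i)) v := by
    refine Finset.sum_congr rfl fun i hi => Finset.sum_congr rfl fun j hj => ?_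
    have h1 : (S ^ n) (K (p i) (p j) (u j)) = K (p i) (p j) ((S ^ n) (u j)) :=
      congrArg (fun A : H →L[ℂ] H => A (u j)) ((hcomm i hi j hj).pow_left n).eq
    have h2 : adjoint (S ^ n) = S ^ n := (hS.pow n).star_eq
    rw [← h1, ← adjoint_inner_right (S ^ n), h2]
  let a (n : ℕ) : ℝ := (kernelForm K p s (fun i => (S ^ n) (h i)) h).re
  have := apply_one_le_apply_zero_of_sq_le (a := a)
    (M := ∑ i ∈ s, ∑ j ∈ s, ‖K (p i) (p j)‖ * ‖h j‖ * ‖h i‖) (by simpa [a] using hpos h)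
    (fun n => ?_) (fun n => ?_)
  · simpa [a, Function.comp_def] using this
  · refine (Complex.re_le_norm _).trans ((norm_kernelForm_le _ _).trans ?_)
    gcongr with i _ j _
    induction n with
    | zero => simp
    | succ n ih =>
      rw [pow_succ']
      exact (S.le_of_opNorm_le hS1 _).trans (by rw [one_mul]; exact ih)
  -- The quadratic in `t` is the form at `Sⁿh - th`.
  · have := discrim_le_zero (a := a 0) (b := -2 * a n) (c := a (2 * n)) fun t => ?_
    · rw [discrim] at this
      linarith
    have := hpos ((fun i => (S ^ n) (h i)) - (t : ℂ) • h)
    have e : kernelForm K p s h (fun i => (S ^ n) (h i))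
      = kernelForm K p s (fun i => (S ^ n) (h i)) h := move n h h
    rw [kernelForm_sub_smul_self, move, e] at this
    have e2 (x : H) : (S ^ n) ((S ^ n) x) = (S ^ (2 * n)) x := by
      rw [two_mul, pow_add]
      rfl
    simp only [e2] at this
    have e0 (x : H) : (S ^ 0) x = x := by simp
    simp only [a, e0]
    simp only [Complex.add_re, Complex.sub_re, ← Complex.ofReal_mul, Complex.re_ofReal_mul] at this
    linarith

end KernelForm

/-! ### Positivity of the kernel. -/

section Positivity

variable {ι G : Type*} [Group G] [Lattice G] [MulLeftMono G]

/-- The members of the family `p` over `B` have no common lower bound `> e`. -/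
def IsCoprimeOn (p : ι → Submonoid.oneLE G) (B : Finset ι) : Prop :=
  ∀ r : Submonoid.oneLE G, (∀ i ∈ B, (r : G) ≤ p i) → r = 1

theorem IsCoprimeOn.mono {p q : ι → Submonoid.oneLE G} {B : Finset ι} (h : IsCoprimeOn p B)
    (hqp : ∀ i, (q i : G) ≤ p i) : IsCoprimeOn q B :=
  fun r hr => h r fun i hi => (hr i hi).trans (hqp i)

variable [MulRightMono G]
variable {H : Type*} [NormedAddCommGroup H] [InnerProductSpace ℂ H] [CompleteSpace H]

/-- If the family `p` arises from `q` by multiplying the members in `B` by an element `g` orthogonal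
to the other members, then positivity of the kernel passes from `q` to `p`. -/
theorem re_kernelForm_nonneg_of_mul_left {T : Rep G H} (hT : IsContractive T)
    (hN : IsNicaCovariant T) {g : Submonoid.oneLE G} {p q : ι → Submonoid.oneLE G}
    {s B : Finset ι} [DecidableEq ι] (hB : ∀ i ∈ s, i ∈ B → p i = g * q i)
    (hA : ∀ i ∈ s, i ∉ B → p i = q i ∧ (g : G) ⊓ q i = 1)
    (hq : ∀ t ⊆ s, ∀ h : ι → H, 0 ≤ (kernelForm (repKernel T) q t h h).re) (h : ι → H) :
    0 ≤ (kernelForm (repKernel T) p s h h).re := by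
  set S : H →L[ℂ] H := T g ∘L adjoint (T g) with hS
  set A := s.filter (· ∉ B) with hAdef
  set h' : ι → H := fun i => if i ∈ B then h i else adjoint (T g) (h i) with hh'
  have hcomm : ∀ i ∈ A, ∀ j ∈ A, Commute S (repKernel T (q i) (q j)) := by
    intro i hi j hj
    rw [hAdef, Finset.mem_filter] at hi hj
    have h1 : Commute (T g) (repKernel T (q i) (q j)) := by
      ext x
      exact repKernel_commute hN (hA i hi.1 hi.2).2 (hA j hj.1 hj.2).2 x
    have h2 : Commute (star (T g)) (repKernel T (q i) (q j)) := by
      rw [← (repKernel_isHermitian T).apply, commute_star_star]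
      ext x
      exact repKernel_commute hN (hA j hj.1 hj.2).2 (hA i hi.1 hi.2).2 x
    exact h1.mul_left h2
  have hSsa : IsSelfAdjoint S := IsSelfAdjoint.mul_star_self (T g)
  have hS1 : ‖S‖ ≤ 1 := by
    refine (opNorm_comp_le _ _).trans (mul_le_one₀ (hT g) (norm_nonneg _) ?_)
    rw [LinearIsometryEquiv.norm_map]
    exact hT g
  -- Outside `B`, the choice of `h'` turns a block `K` into `T(g) K T(g)† = KS`, hence the
  -- correction over `A`; all other blocks agree exactly.
  have key : kernelForm (repKernel T) p s h h = kernelForm (repKernel T) q s h' h' +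
      (kernelForm (repKernel T) q A h h - kernelForm (repKernel T) q A (S ∘ h) h) := by
    simp only [kernelForm, hAdef, Finset.sum_filter, ← Finset.sum_add_distrib,
      ← Finset.sum_sub_distrib]
    refine Finset.sum_congr rfl fun i hi => ?_
    by_cases hiB : i ∈ B
    · simp only [hiB, not_true_eq_false, if_false, sub_zero, add_zero]
      refine Finset.sum_congr rfl fun j hj => ?_
      by_cases hjB : j ∈ B
      · simp [hh', hiB, hjB, hB i hi hiB, hB j hj hjB, repKernel_mul_left]
      · simp [hh', hiB, hjB, hB i hi hiB, (hA j hj hjB).1,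
          repKernel_mul_left_right hN (hA j hj hjB).2]
    · simp only [hiB, not_false_eq_true, if_true, ← Finset.sum_add_distrib,
        ← Finset.sum_sub_distrib]
      refine Finset.sum_congr rfl fun j hj => ?_
      by_cases hjB : j ∈ B
      · simp [hh', hiB, hjB, hB j hj hjB, (hA i hi hiB).1, adjoint_inner_right,
          repKernel_mul_right hN (hA i hi hiB).2]
      · simp [hh', hiB, hjB, (hA j hj hjB).1, (hA i hi hiB).1, adjoint_inner_right, hS,
          repKernel_commute hN (hA i hi hiB).2 (hA j hj hjB).2]
  have hle := re_kernelForm_comp_le (hq A (Finset.filter_subset _ _)) hSsa hS1 hcomm h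
  have := hq s subset_rfl h'
  rw [key, Complex.add_re, Complex.sub_re]
  linarith

open Classical in
theorem re_kernelForm_repKernel_nonneg {T : Rep G H} (hT : IsContractive T)
    (hN : IsNicaCovariant T) (p : ι → Submonoid.oneLE G) (s : Finset ι) (h : ι → H) :
    0 ≤ (kernelForm (repKernel T) p s h h).re := by
  -- The induction is on the number of nonempty subfamilies with a common lower bound `> e`.
  let bad (p : ι → Submonoid.oneLE G) (s : Finset ι) : Finset (Finset ι) :=
    s.powerset.filter fun B => B.Nonempty ∧ ¬ IsCoprimeOn p B
  have mem_bad {p : ι → Submonoid.oneLE G} {s B : Finset ι} :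
      B ∈ bad p s ↔ B ⊆ s ∧ B.Nonempty ∧ ¬ IsCoprimeOn p B := by
    simp [bad]
  induction hn : (bad p s).card using Nat.strong_induction_on generalizing p s h with
  | _ n ih =>
  subst hn
  rcases (bad p s).eq_empty_or_nonempty with he | hne
  · have hp : ∀ i ∈ s, p i = 1 := fun i hi => by
      by_contra hpi
      have : {i} ∈ bad p s := mem_bad.2 ⟨by simpa using hi, by simp, fun hc =>
        hpi (hc (p i) (by simp))⟩
      simp [he] at this
    have : kernelForm (repKernel T) p s h h = inner ℂ (∑ j ∈ s, h j) (∑ i ∈ s, h i) := by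
      rw [inner_sum]
      refine Finset.sum_congr rfl fun i hi => ?_
      rw [sum_inner]
      refine Finset.sum_congr rfl fun j hj => ?_
      rw [hp i hi, hp j hj, repKernel_self]
      rfl
    rw [this]
    exact inner_self_nonneg (𝕜 := ℂ)
  · obtain ⟨B, hBmem, hBmax⟩ := Finset.exists_max_image (bad p s) Finset.card hne
    obtain ⟨hBs, hBne, hBbad⟩ := mem_bad.1 hBmem
    let g : Submonoid.oneLE G :=
      ⟨B.inf' hBne fun i => (p i : G),
        Submonoid.mem_oneLE.2 (Finset.le_inf' _ _ fun i _ => (p i).2)⟩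
    have hgp : ∀ i ∈ B, (g : G) ≤ p i := fun i hi => Finset.inf'_le _ hi
    let q : ι → Submonoid.oneLE G := fun i => if i ∈ B then leftQuot g (p i) else p i
    have hqp : ∀ i, (q i : G) ≤ p i := fun i => by
      by_cases hi : i ∈ B
      · simp only [q, hi, if_true]
        exact inv_mul_sup_one_le g.2 (p i).2
      · simp [q, hi]
    have hsub : bad q s ⊂ bad p s := by
      refine (Finset.ssubset_iff_of_subset fun C hC => ?_).2 ⟨B, hBmem, fun hB => ?_⟩
      · obtain ⟨h1, h2, h3⟩ := mem_bad.1 hC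
        exact mem_bad.2 ⟨h1, h2, fun h4 => h3 (h4.mono hqp)⟩
      · refine (mem_bad.1 hB).2.2 fun r hr => ?_
        -- A common lower bound `r` left after the division would make `gr` a lower bound of the
        -- original family over `B`, whose meet is `g`.
        have hgr : (g : G) * r ≤ g := Finset.le_inf' hBne _ fun i hi => by
          have := mul_le_mul_right (hr i hi) (g : G)
          have e : q i = leftQuot g (p i) := by simp [q, hi]
          have e' : (g : G) * leftQuot g (p i) = p i :=
            congrArg Subtype.val (mul_leftQuot_of_le (hgp i hi))
          rwa [e, e'] at this
        exact Subtype.ext (le_antisymm (by simpa using hgr) r.2)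
    refine re_kernelForm_nonneg_of_mul_left hT hN (g := g) (q := q) (B := B)
      (fun i _ hi => by simp [q, hi, mul_leftQuot_of_le (hgp i hi)])
      (fun i hi hiB => ⟨by simp [q, hiB], ?_⟩) (fun t ht h => ?_) h
    -- Maximality of `B`: a common lower bound `> e` of `g` and `p i` would make `insert i B` bad.
    · have hcop : IsCoprimeOn p (insert i B) := by
        by_contra hc
        have := hBmax _ (mem_bad.2 ⟨Finset.insert_subset hi hBs, by simp, hc⟩)
        simp [hiB] at this
      have hr : (1 : G) ≤ (g : G) ⊓ p i := le_inf g.2 (p i).2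
      have := hcop ⟨(g : G) ⊓ p i, hr⟩ fun j hj => by
        rcases Finset.mem_insert.1 hj with rfl | hj
        · exact inf_le_right
        · exact inf_le_left.trans (hgp j hj)
      simpa [q, hiB] using congrArg (Subtype.val) this
    · refine ih _ (lt_of_le_of_lt (Finset.card_le_card ?_) (Finset.card_lt_card hsub)) q t h rfl
      intro C hC
      obtain ⟨h1, h2⟩ := mem_bad.1 hC
      exact mem_bad.2 ⟨h1.trans ht, h2⟩

open scoped ComplexOrder in
theorem repKernel_posSemidef {T : Rep G H} (hT : IsContractive T) (hN : IsNicaCovariant T) :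
    (repKernel T).PosSemidef := by
  refine (RKHS.posSemidef_tfae.out 0 2 rfl rfl).2 ⟨repKernel_isHermitian T, fun v => ?_⟩
  have := re_kernelForm_repKernel_nonneg hT hN id v.support v
  rw [kernelForm, Finset.sum_comm] at this
  exact this

end Positivity

/-! ### Isometries from equal Gram matrices. -/

section Gram

variable {ι K L : Type*} [NormedAddCommGroup K] [InnerProductSpace ℂ K]
  [NormedAddCommGroup L] [InnerProductSpace ℂ L]

theorem norm_linearCombination_eq_of_inner_eq {a : ι → K} {b : ι → L}
    (hab : ∀ i j, inner ℂ (a i) (a j) = inner ℂ (b i) (b j)) (f : ι →₀ ℂ) :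
    ‖Finsupp.linearCombination ℂ a f‖ = ‖Finsupp.linearCombination ℂ b f‖ := by
  simp only [@norm_eq_sqrt_re_inner ℂ, Finsupp.linearCombination_apply, Finsupp.sum, sum_inner,
    inner_sum, inner_smul_left, inner_smul_right, hab]

/-- Families of vectors with the same Gram matrix, the first of which is total, are related by an
isometry. -/
theorem exists_linearIsometry_of_inner_eq [CompleteSpace L] {a : ι → K} {b : ι → L}
    (ha : (Submodule.span ℂ (Set.range a)).topologicalClosure = ⊤)
    (hab : ∀ i j, inner ℂ (a i) (a j) = inner ℂ (b i) (b j)) :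
    ∃ W : K →L[ℂ] L, Isometry W ∧ ∀ i, W (a i) = b i := by
  have hd : DenseRange (Finsupp.linearCombination ℂ a) := by
    rw [DenseRange, ← LinearMap.coe_range, Finsupp.range_linearCombination]
    exact Submodule.dense_iff_topologicalClosure_eq_top.2 ha
  have hn : ∀ f, ‖Finsupp.linearCombination ℂ b f‖ ≤ 1 * ‖Finsupp.linearCombination ℂ a f‖ :=
    fun f => by rw [one_mul, norm_linearCombination_eq_of_inner_eq hab]
  let W := (Finsupp.linearCombination ℂ b).extendOfNorm (Finsupp.linearCombination ℂ a)
  have hW : ∀ f, W (Finsupp.linearCombination ℂ a f) = Finsupp.linearCombination ℂ b f :=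
    LinearMap.extendOfNorm_eq hd ⟨1, hn⟩
  refine ⟨W, AddMonoidHomClass.isometry_of_norm W fun x => ?_, fun i => ?_⟩
  · refine hd.induction_on (p := fun x => ‖W x‖ = ‖x‖) x
      (isClosed_eq (by fun_prop) (by fun_prop)) fun f => ?_
    rw [hW, norm_linearCombination_eq_of_inner_eq hab]
  · simpa using hW (Finsupp.single i 1)

end Gram

/-! ### Construction of the dilation, and its covariance. -/

section Dilation

variable {G : Type*} [Group G] [Lattice G] [MulLeftMono G]
variable {H : Type*} [NormedAddCommGroup H] [InnerProductSpace ℂ H] [CompleteSpace H]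
variable {K : Type*} [NormedAddCommGroup K] [InnerProductSpace ℂ K]

theorem IsIsometric.inner_map_map {V : Rep G K} (hV : IsIsometric V)
    (p : Submonoid.oneLE G) (x y : K) :
    inner ℂ (V p x) (V p y) = inner ℂ x y :=
  (LinearMap.norm_map_iff_inner_map_map (V p)).1
    ((AddMonoidHomClass.isometry_iff_norm (V p)).1 (hV p)) x y

/-- Both operators factor through `V (p ⊓ q)` on the left, and this isometry cancels. -/
theorem IsIsometric.inner_map_map_leftQuot [MulRightMono G] {V : Rep G K}
    (hV : IsIsometric V) (p q : Submonoid.oneLE G) (x y : K) : inner ℂ (V q x) (V p y) =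
      inner ℂ (V (leftQuot p q) x) (V (leftQuot q p) y) := by
  obtain ⟨r, hq, hp⟩ := exists_mul_leftQuot p q
  have h1 : V q x = V r (V (leftQuot p q) x) := by
    change V q x = (V r * V (leftQuot p q)) x
    rw [← map_mul, hq]
  have h2 : V p y = V r (V (leftQuot q p) y) := by
    change V p y = (V r * V (leftQuot q p)) y
    rw [← map_mul, hp]
  rw [h1, h2, hV.inner_map_map]

variable [CompleteSpace K]

/-- A Kolmogorov decomposition of the kernel of `T` carries a dilation of `T`. -/
theorem exists_dilation_of_kolmogorov [MulRightMono G] (T : Rep G H)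
    (Φ : Submonoid.oneLE G → H →L[ℂ] K)
    (hΦ : ∀ p q x y, inner ℂ (Φ q x) (Φ p y) = inner ℂ (repKernel T p q x) y)
    (hd : (Submodule.span ℂ {x | ∃ p h, Φ p h = x}).topologicalClosure = ⊤) :
    ∃ (V : Rep G K) (J : H →ₗᵢ[ℂ] K),
      IsIsometricDilation T V J ∧ IsMinimal V J ∧ IsRegular T V J := by
  have hrange : Set.range (fun i : Submonoid.oneLE G × H => Φ i.1 i.2) = {x | ∃ p h, Φ p h = x} := by
    ext x
    simp
  -- Left invariance of the kernel gives the translated family the same Gram matrix.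
  have hex (g : Submonoid.oneLE G) := exists_linearIsometry_of_inner_eq
    (a := fun i : Submonoid.oneLE G × H => Φ i.1 i.2) (b := fun i => Φ (g * i.1) i.2)
    (by rw [hrange, hd]) fun i j => by rw [hΦ, hΦ, repKernel_mul_left]
  choose W hWiso hW using hex
  replace hW : ∀ g p x, W g (Φ p x) = Φ (g * p) x := fun g p x => hW g (p, x)
  have hext {A B : K →L[ℂ] K} (h : ∀ p x, A (Φ p x) = B (Φ p x)) : A = B := by
    refine ContinuousLinearMap.ext_on (Submodule.dense_iff_topologicalClosure_eq_top.2 hd) ?_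
    rintro _ ⟨p, x, rfl⟩
    exact h p x
  let V : Rep G K :=
    { toFun := W
      map_one' := hext fun p x => by rw [hW, one_mul]; rfl
      map_mul' := fun g k => hext fun p x => by
        change _ = W g (W k (Φ p x))
        rw [hW, hW, hW, mul_assoc] }
  have hV : ∀ g p x, V g (Φ p x) = Φ (g * p) x := hW
  let J : H →ₗᵢ[ℂ] K :=
    { toLinearMap := (Φ 1 : H →ₗ[ℂ] K)
      norm_map' := fun x => by
        simp [@norm_eq_sqrt_re_inner ℂ, hΦ, repKernel_self, -inner_self_eq_norm_sq_to_K] }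
  have hJ : ∀ x, J x = Φ 1 x := fun _ => rfl
  refine ⟨V, J, ⟨hWiso, fun p => ?_⟩, ?_, fun p q hpq => ?_⟩
  · ext x
    refine ext_inner_right ℂ fun y => ?_
    simp [adjoint_inner_left, hJ, hV, hΦ, inner_repKernel, leftQuot_one_left, leftQuot_one_right]
  · rw [IsMinimal, ← hd]
    simp [hJ, hV, eq_comm]
  · ext x
    refine ext_inner_right ℂ fun y => ?_
    simp [adjoint_inner_left, hJ, hV, hΦ, inner_repKernel, leftQuot_of_inf_eq_one hpq,
      leftQuot_of_inf_eq_one (inf_comm (p : G) q ▸ hpq)]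

variable {T : Rep G H} {V : Rep G K} {J : H →ₗᵢ[ℂ] K}

variable [MulRightMono G]

/-- The Gram matrix of a regular isometric dilation is the kernel of `T`. -/
theorem IsRegular.inner_map_map (hR : IsRegular T V J) (hV : IsIsometric V)
    (p q : Submonoid.oneLE G) (x y : H) :
    inner ℂ (V q (J x)) (V p (J y)) = inner ℂ (repKernel T p q x) y := by
  have h := congrArg (fun A : H →L[ℂ] H => inner ℂ (A x) y)
    (hR _ _ (leftQuot_inf_leftQuot q p))
  simp only [comp_apply, adjoint_inner_left] at h
  rw [inner_repKernel, ← h]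
  exact hV.inner_map_map_leftQuot p q _ _

theorem IsRegular.isNicaCovariant (hN : IsNicaCovariant T) (hV : IsIsometric V)
    (hM : IsMinimal V J) (hR : IsRegular T V J) : IsNicaCovariant V := by
  have hd := Submodule.dense_iff_topologicalClosure_eq_top.2 hM
  have key (t r : Submonoid.oneLE G) (h : H) : adjoint (V t) (V r (J h)) =
      V (leftQuot t r) (J (adjoint (T (leftQuot r t)) h)) := by
    have h1 : adjoint (V t) (V r (J h)) =
        adjoint (V (leftQuot r t)) (V (leftQuot t r) (J h)) := by
      refine ext_inner_right ℂ fun y => ?_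
      rw [adjoint_inner_left, adjoint_inner_left]
      exact hV.inner_map_map_leftQuot t r _ _
    rw [h1]
    -- After the common factor is cancelled the two quotients are orthogonal, so testing against `V
    -- m (J k)` reduces the claim to the kernel identity `K(gm, p) = K(m, p) T(g)†`.
    refine innerSL_inj.1 (ContinuousLinearMap.ext_on hd ?_)
    rintro _ ⟨m, k, rfl⟩
    have e : V (leftQuot r t) (V m (J k)) = V (leftQuot r t * m) (J k) := by rw [map_mul]; rfl
    rw [innerSL_apply_apply, innerSL_apply_apply, adjoint_inner_left, e, hR.inner_map_map hV,
      hR.inner_map_map hV, repKernel_mul_left_right hN (leftQuot_inf_leftQuot r t), comp_apply]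
  intro s t hst
  refine ContinuousLinearMap.ext_on hd ?_
  rintro _ ⟨r, h, rfl⟩
  have e : V s (V r (J h)) = V (s * r) (J h) := by rw [map_mul]; rfl
  simp only [comp_apply]
  rw [e, key, key, leftQuot_mul_right hst, leftQuot_mul_left hst, map_mul]
  rfl

end Dilation

end LatticeOrderedSemigroup

theorem corollary4p2
    {G : Type u} [Group G] [Lattice G] [MulLeftMono G] [MulRightMono G]
    {H : Type v} [NormedAddCommGroup H] [InnerProductSpace ℂ H] [CompleteSpace H]
    (T : Rep G H) (hT : IsContractive T) (hN : IsNicaCovariant T) :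
    (∃ (K : Type (max u v)) (_ : NormedAddCommGroup K) (_ : InnerProductSpace ℂ K)
      (_ : CompleteSpace K) (V : Rep G K) (J : H →ₗᵢ[ℂ] K),
      IsIsometricDilation T V J ∧ IsMinimal V J ∧ IsRegular T V J) ∧
    ∀ (K : Type w) [NormedAddCommGroup K] [InnerProductSpace ℂ K] [CompleteSpace K]
      (V : Rep G K) (J : H →ₗᵢ[ℂ] K),
      IsIsometricDilation T V J → IsMinimal V J → IsRegular T V J → IsNicaCovariant V := by
  refine ⟨?_, fun K _ _ _ V J hV hM hR => hR.isNicaCovariant hN hV.1 hM⟩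
  -- The reproducing kernel Hilbert space of the kernel serves as Kolmogorov decomposition.
  have : Fact (repKernel T).PosSemidef := ⟨repKernel_posSemidef hT hN⟩
  refine ⟨RKHS.OfKernel (repKernel T), inferInstance, inferInstance, inferInstance,
    exists_dilation_of_kolmogorov T (RKHS.kerFun (RKHS.OfKernel (repKernel T)))
      (fun p q x y => ?_) ?_⟩
  · rw [← RKHS.kernel_inner, RKHS.OfKernel.kernel_ofKernel]
  · exact RKHS.kerFun_dense (RKHS.OfKernel (repKernel T))
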